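/- Let $p$ be a prime number. A pro-$p$ group is a profinite group (compact, totally disconnected topological group) in which every open normal subgroup has index a power of $p$. Let $G$ be a uniform pro-$p$ group, that is, a pro-$p$ group such that: (i) $G$ is topologically finitely generated; (ii) $G$ is powerful: if $p$ is odd, $G/\overline{G^p}$ is abelian, and if $p=2$, $G/\overline{G^4}$ is abelian, where $G^n$ is the subgroup generated by all $n$-th powers and the bar denotes topological closure; (iii) $[P_i(G):P_{i+1}(G)]=[G:P_2(G)]$ for all $i\ge 1$, where $P_1(G)=G$ and $P_{i+1}(G)=\overline{P_i(G)^p[P_i(G),G]}$. Let $\Phi(G)$ be the intersection of all maximal proper open subgroups of $G$; the dimension of $G$ is $d(G)=\dim_{\mathbb{F}_p}G/\Phi(G)$. If $d(G)\in\{1,2\}$, then $G$ has a quotient isomorphic to $\mathbb{Z}_p$: there is a closed normal subgroup $N$ of $G$ such that $G/N$ is isomorphic, as a topological group, to the additive group $\mathbb{Z}_p$ of $p$-adic integers. -/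

import Mathlib

namespace UniformProP

/-- `H ^ n`: the subgroup generated by the `n`-th powers of the elements of `H`. -/
def powSubgroup {G : Type*} [Group G] (H : Subgroup G) (n : ℕ) : Subgroup G :=
  Subgroup.closure ((fun x : G => x ^ n) '' (H : Set G))

instance powSubgroup_normal {G : Type*} [Group G] (H : Subgroup G) [H.Normal] (n : ℕ) :
    (powSubgroup H n).Normal := by
  refine ⟨fun x hx g => ?_⟩
  induction hx using Subgroup.closure_induction with
  | mem x hx =>
    obtain ⟨y, hy, rfl⟩ := hx
    exact Subgroup.subset_closure
      ⟨g * y * g⁻¹, Subgroup.Normal.conj_mem ‹_› y hy g, by simp [conj_pow]⟩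
  | one => simp
  | mul x y _ _ hx hy =>
    have h : g * (x * y) * g⁻¹ = (g * x * g⁻¹) * (g * y * g⁻¹) := by group
    rw [h]
    exact mul_mem hx hy
  | inv x _ hx =>
    have h : g * x⁻¹ * g⁻¹ = (g * x * g⁻¹)⁻¹ := by group
    rw [h]
    exact inv_mem hx

instance topologicalClosure_normal {G : Type*} [Group G] [TopologicalSpace G]
    [IsTopologicalGroup G] (H : Subgroup G) [H.Normal] : H.topologicalClosure.Normal :=
  Subgroup.is_normal_topologicalClosure H

/-- For a profinite group `G` (a compact, totally disconnected topological group), this says that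
`G` is a pro-`p` group: every open normal subgroup has index a power of `p`. -/
def IsProP (p : ℕ) (G : Type*) [Group G] [TopologicalSpace G] : Prop :=
  ∀ U : Subgroup G, U.Normal → IsOpen (U : Set G) → ∃ k : ℕ, U.index = p ^ k

/-- Some finite subset generates `G` topologically. -/
def IsTopologicallyFG (G : Type*) [Group G] [TopologicalSpace G] [IsTopologicalGroup G] : Prop :=
  ∃ X : Set G, X.Finite ∧ (Subgroup.closure X).topologicalClosure = ⊤

/-- The quotient of `G` by the closure of `G ^ p` (`p` odd), respectively of `G ^ 4` (`p = 2`),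
is abelian. -/
def IsPowerful (p : ℕ) (G : Type*) [Group G] [TopologicalSpace G] [IsTopologicalGroup G] : Prop :=
  (Odd p ∧ ∀ x y : G ⧸ (powSubgroup (⊤ : Subgroup G) p).topologicalClosure, x * y = y * x) ∨
  (p = 2 ∧ ∀ x y : G ⧸ (powSubgroup (⊤ : Subgroup G) 4).topologicalClosure, x * y = y * x)

/-- The lower `p`-series, with indices shifted by one: `lowerPSeries p G i` is the term usually
written `P_{i+1}(G)`. So the series starts at `G`, and each next term is the closure of
`P ^ p [P, G]`, the subgroup generated by `P ^ p` and `[P, G]`. -/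
def lowerPSeries (p : ℕ) (G : Type*) [Group G] [TopologicalSpace G] [IsTopologicalGroup G] :
    ℕ → Subgroup G
  | 0 => ⊤
  | i + 1 => (powSubgroup (lowerPSeries p G i) p ⊔
      ⁅lowerPSeries p G i, (⊤ : Subgroup G)⁆).topologicalClosure

/-- Uniform (that is, uniformly powerful) pro-`p` groups, among profinite groups. -/
structure IsUniform (p : ℕ) (G : Type*) [Group G] [TopologicalSpace G] [IsTopologicalGroup G] :
    Prop where
  isProP : IsProP p G
  powerful : IsPowerful p G
  finitelyGenerated : IsTopologicallyFG G
  index_eq : ∀ i : ℕ, (lowerPSeries p G (i + 1)).relIndex (lowerPSeries p G i) =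
    (lowerPSeries p G 1).index

/-- The Frattini subgroup of a profinite group: the intersection of all maximal proper open
subgroups. -/
def frattiniSubgroup (G : Type*) [Group G] [TopologicalSpace G] : Subgroup G :=
  sInf {M : Subgroup G | Maximal (fun H : Subgroup G => IsOpen (H : Set G) ∧ H ≠ ⊤) M}

theorem isOpen_comap_conj {G : Type*} [Group G] [TopologicalSpace G] [IsTopologicalGroup G]
    (g : G) {M : Subgroup G} (hM : IsOpen (M : Set G)) :
    IsOpen ((M.comap (MulAut.conj g).toMonoidHom : Subgroup G) : Set G) := by
  have hc : Continuous fun x : G => g * x * g⁻¹ := by fun_prop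
  exact hM.preimage hc

theorem comap_conj_inv_comap {G : Type*} [Group G] (g : G) (M : Subgroup G) :
    (M.comap (MulAut.conj g).toMonoidHom).comap (MulAut.conj g⁻¹).toMonoidHom = M := by
  ext x
  simp [Subgroup.mem_comap, mul_assoc]

theorem comap_conj_ne_top {G : Type*} [Group G] (g : G) {M : Subgroup G} (hM : M ≠ ⊤) :
    M.comap (MulAut.conj g).toMonoidHom ≠ ⊤ := by
  intro h
  apply hM
  rw [← comap_conj_inv_comap g M, h, Subgroup.comap_top]

instance frattiniSubgroup_normal (G : Type*) [Group G] [TopologicalSpace G]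
    [IsTopologicalGroup G] : (frattiniSubgroup G).Normal := by
  refine ⟨fun x hx g => ?_⟩
  rw [frattiniSubgroup, Subgroup.mem_sInf] at hx ⊢
  intro M (hM : Maximal (fun H : Subgroup G => IsOpen (H : Set G) ∧ H ≠ ⊤) M)
  refine hx (M.comap (MulAut.conj g).toMonoidHom)
    ⟨⟨isOpen_comap_conj g hM.prop.1, comap_conj_ne_top g hM.prop.2⟩, fun K hK hle => ?_⟩
  have h1 : M ≤ K.comap (MulAut.conj g⁻¹).toMonoidHom := by
    rw [← comap_conj_inv_comap g M]
    exact Subgroup.comap_mono hle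
  have h2 := hM.2 ⟨isOpen_comap_conj g⁻¹ hK.1, comap_conj_ne_top g⁻¹ hK.2⟩ h1
  have h3 := Subgroup.comap_mono (f := (MulAut.conj g).toMonoidHom) h2
  have h4 := comap_conj_inv_comap g⁻¹ K
  rw [inv_inv] at h4
  rwa [h4] at h3

/-- `G / Φ(G)` is an `𝔽_p`-vector space of dimension `d`, that is, it is isomorphic to `𝔽_p ^ d`
(a group isomorphism is the same as an `𝔽_p`-linear one). -/
def HasDimension (p : ℕ) (G : Type*) [Group G] [TopologicalSpace G] [IsTopologicalGroup G]
    (d : ℕ) : Prop :=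
  Nonempty ((G ⧸ frattiniSubgroup G) ≃* Multiplicative (Fin d → ZMod p))

end UniformProP

namespace UniformProP

open scoped commutatorElement
open Filter Topology

/-! ### Powers and commutators in finite `p`-groups -/

/-! The plan is to map `G` onto cyclic groups of order `p ^ (n + 1)` for every `n`, and then to pass
to a limit.

For the cyclic quotients, let `Q` be the quotient of `G` by `lowerPSeries p G m`. Uniformity gives
`|Q| ≥ p ^ (d * m)`, and the exponent of `Q` divides `p ^ m`. Moreover `Q` is powerful and generated
by two elements `x, y`, so its commutator subgroup is cyclic, generated by `⁅x, y⁆`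
(`commutator_le_zpowers`). Its order is thus at most `p ^ m` if `d = 2`, and it is trivial if `d =
1`, where `y = 1`. Either way the abelianization has order at least `p ^ m`. With `m = 2 * n + 1`
this exceeds `p ^ (2 * n)`, the largest possible order of a two-generated abelian group killed by `p
^ n`. Hence some element survives the power `p ^ n`, and a cyclic quotient of order `p ^ (n + 1)`
exists (`exists_surjective_zmod`).

These homomorphisms need not be compatible, but each sends `lowerPSeries p G k` into the multiples
of `p ^ k`. This equicontinuity makes a pointwise ultralimit of their lifts to `ℤ_[p]` a continuous
surjective homomorphism (`exists_limit_hom`); its kernel is the required subgroup. -/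

theorem pow_mem_powSubgroup {G : Type*} [Group G] {H : Subgroup G} {x : G} (hx : x ∈ H) (n : ℕ) :
    x ^ n ∈ powSubgroup H n :=
  Subgroup.subset_closure ⟨x, hx, rfl⟩

theorem powSubgroup_le {G : Type*} [Group G] {H K : Subgroup G} {n : ℕ}
    (h : ∀ x ∈ H, x ^ n ∈ K) : powSubgroup H n ≤ K := by
  rw [powSubgroup, Subgroup.closure_le]
  rintro _ ⟨x, hx, rfl⟩
  exact h x hx

theorem map_powSubgroup {G K : Type*} [Group G] [Group K] (f : G →* K) (H : Subgroup G) (n : ℕ) :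
    (powSubgroup H n).map f = powSubgroup (H.map f) n := by
  rw [powSubgroup, powSubgroup, MonoidHom.map_closure]
  congr 1
  ext k
  simp [Set.mem_image]

theorem map_powSubgroup_top {G K : Type*} [Group G] [Group K] {f : G →* K}
    (hf : Function.Surjective f) (n : ℕ) :
    (powSubgroup ⊤ n).map f = powSubgroup ⊤ n := by
  rw [map_powSubgroup, Subgroup.map_top_of_surjective f hf]

theorem map_commutator_top {G K : Type*} [Group G] [Group K] {f : G →* K}
    (hf : Function.Surjective f) : (commutator G).map f = commutator K := by
  rw [commutator_def, Subgroup.map_commutator, Subgroup.map_top_of_surjective f hf, commutator_def]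

/-- The class two power formula. -/
theorem mul_pow_of_central {G : Type*} [Group G] {x u z : G} (h : u * x = x * u * z)
    (hx : Commute z x) (hu : Commute z u) (n : ℕ) :
    (x * u) ^ n = x ^ n * u ^ n * z ^ (n.choose 2) := by
  have h1 (n : ℕ) : u ^ n * x = x * u ^ n * z ^ n := by
    induction n with
    | zero => simp
    | succ n ih =>
      calc u ^ (n + 1) * x = u * (u ^ n * x) := by rw [pow_succ', mul_assoc]
        _ = (u * x) * (u ^ n * z ^ n) := by rw [ih]; group
        _ = x * u * (z * u ^ n) * z ^ n := by rw [h]; group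
        _ = x * u * (u ^ n * z) * z ^ n := by rw [(hu.pow_right n).eq]
        _ = x * u ^ (n + 1) * z ^ (n + 1) := by rw [pow_succ' u, pow_succ' z]; group
  induction n with
  | zero => simp
  | succ n ih =>
    calc (x * u) ^ (n + 1) = x ^ n * u ^ n * (z ^ n.choose 2 * (x * u)) := by
          rw [pow_succ, ih, mul_assoc]
      _ = x ^ n * u ^ n * ((x * u) * z ^ n.choose 2) := by
          rw [((hx.mul_right hu).pow_left _).eq]
      _ = x ^ n * (u ^ n * x) * u * z ^ n.choose 2 := by group
      _ = x ^ n * x * u ^ n * (z ^ n * u) * z ^ n.choose 2 := by rw [h1]; group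
      _ = x ^ n * x * u ^ n * (u * z ^ n) * z ^ n.choose 2 := by rw [(hu.pow_left n).eq]
      _ = x ^ (n + 1) * u ^ (n + 1) * z ^ (n + 1).choose 2 := by
          rw [Nat.choose_succ_succ' n 1, Nat.choose_one_right, pow_add, pow_succ, pow_succ]
          group

/-- Conjugating `x` by `g` multiplies it by `u = ⁅x⁻¹, g⁆`. Since `u` commutes with `x` up to a
central commutator `z`, the class two formula applies, and the two divisibilities kill `u ^ q` and
`z ^ (q.choose 2)`. So `x ^ q` is fixed by conjugation. -/
theorem powSubgroup_le_center_of_commutator_le_center {G : Type*} [Group G] {p q : ℕ}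
    (hq : p ∣ q) (hq2 : p ∣ q.choose 2)
    (hpow : ∀ d ∈ commutator G, d ^ p = 1) (hD : commutator G ≤ powSubgroup ⊤ q)
    (hX : ⁅powSubgroup (⊤ : Subgroup G) q, (⊤ : Subgroup G)⁆ ≤ Subgroup.center G) :
    powSubgroup (⊤ : Subgroup G) q ≤ Subgroup.center G := by
  refine powSubgroup_le fun x _ => Subgroup.mem_center_iff.2 fun g => ?_
  have hu : ⁅x⁻¹, g⁆ ∈ commutator G :=
    Subgroup.commutator_mem_commutator (Subgroup.mem_top _) (Subgroup.mem_top _)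
  have hz : ⁅⁅x⁻¹, g⁆⁻¹, x⁻¹⁆ ∈ commutator G :=
    Subgroup.commutator_mem_commutator (Subgroup.mem_top _) (Subgroup.mem_top _)
  have hzc : ⁅⁅x⁻¹, g⁆⁻¹, x⁻¹⁆ ∈ Subgroup.center G :=
    hX (Subgroup.commutator_mem_commutator (hD (inv_mem hu)) (Subgroup.mem_top _))
  have key := mul_pow_of_central (x := x) (u := ⁅x⁻¹, g⁆) (z := ⁅⁅x⁻¹, g⁆⁻¹, x⁻¹⁆)
    (by simp only [commutatorElement_def]; group)
    (Subgroup.mem_center_iff.1 hzc _).symm (Subgroup.mem_center_iff.1 hzc _).symm q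
  obtain ⟨a, ha⟩ := hq
  obtain ⟨b, hb⟩ := hq2
  have h1 : x * ⁅x⁻¹, g⁆ = g * x * g⁻¹ := by simp only [commutatorElement_def]; group
  rw [hb, pow_mul ⁅⁅x⁻¹, g⁆⁻¹, x⁻¹⁆, hpow _ hz, one_pow, mul_one, h1, conj_pow, ha,
    pow_mul ⁅x⁻¹, g⁆, hpow _ hu, one_pow, mul_one, mul_inv_eq_iff_eq_mul] at key
  rwa [ha]

theorem powSubgroup_le_center_of_isNilpotent {G : Type*} [Group G] [Group.IsNilpotent G] {p q : ℕ}
    (hq : p ∣ q) (hq2 : p ∣ q.choose 2)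
    (hpow : ∀ d ∈ commutator G, d ^ p = 1) (hD : commutator G ≤ powSubgroup ⊤ q) :
    powSubgroup (⊤ : Subgroup G) q ≤ Subgroup.center G := by
  have key (k : ℕ) : ⁅powSubgroup (⊤ : Subgroup G) q, (⊤ : Subgroup G)⁆ ≤
      Subgroup.lowerCentralSeries ⊤ k := by
    induction k with
    | zero => simp
    | succ k ih =>
      -- Modulo the next term of the lower central series, the inductive hypothesis makes `[G ^ q,
      -- G]` central, so the previous lemma applies to the quotient.
      set L := Subgroup.lowerCentralSeries (⊤ : Subgroup G) (k + 1) with hL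
      have hs := QuotientGroup.mk'_surjective L
      have hP := map_powSubgroup_top hs q
      have hC := map_commutator_top hs
      have hcen : powSubgroup (⊤ : Subgroup (G ⧸ L)) q ≤ Subgroup.center (G ⧸ L) := by
        refine powSubgroup_le_center_of_commutator_le_center hq hq2 ?_ ?_ ?_
        · rw [← hC]
          rintro _ ⟨d, hd, rfl⟩
          rw [← map_pow, hpow d hd, map_one]
        · rw [← hC, ← hP]
          exact Subgroup.map_mono hD
        · rw [← hP, ← Subgroup.map_top_of_surjective _ hs, ← Subgroup.map_commutator,
            Subgroup.map_le_iff_le_comap]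
          refine ih.trans fun a ha => Subgroup.mem_center_iff.2 fun g => ?_
          obtain ⟨g, rfl⟩ := hs g
          rw [← map_mul, ← map_mul, eq_comm, ← mul_inv_eq_one, ← map_inv, ← map_mul,
            QuotientGroup.mk'_apply, QuotientGroup.eq_one_iff]
          have := Subgroup.commutator_mem_commutator ha (Subgroup.mem_top g)
          rw [hL, Subgroup.lowerCentralSeries_succ]
          simpa [commutatorElement_def, mul_assoc] using this
      rw [← hP, Subgroup.map_le_iff_le_comap] at hcen
      refine Subgroup.commutator_le.2 fun a ha g _ => ?_
      have h1 := Subgroup.mem_center_iff.1 (hcen ha) (QuotientGroup.mk' L g)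
      rw [← QuotientGroup.eq_one_iff (N := L), ← QuotientGroup.mk'_apply, map_commutatorElement,
        commutatorElement_eq_one_iff_mul_comm]
      exact h1.symm
  obtain ⟨n, hn⟩ := Subgroup.nilpotent_iff_lowerCentralSeries.1 ‹Group.IsNilpotent G›
  have h := key n
  rw [hn] at h
  intro a ha
  refine Subgroup.mem_center_iff.2 fun g => ?_
  have h1 := Subgroup.mem_bot.1 (h (Subgroup.commutator_mem_commutator ha (Subgroup.mem_top g)))
  exact (commutatorElement_eq_one_iff_mul_comm.1 h1).symm

/-- Centrality makes the cyclic subgroup normal; modulo it the two generators commute, so the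
quotient is abelian. -/
theorem commutator_le_zpowers_of_mem_center {G : Type*} [Group G] {x y : G}
    (hgen : Subgroup.closure {x, y} = ⊤) (hc : ⁅x, y⁆ ∈ Subgroup.center G) :
    commutator G ≤ Subgroup.zpowers ⁅x, y⁆ := by
  have hle : Subgroup.zpowers ⁅x, y⁆ ≤ Subgroup.center G := by simpa using hc
  have hn : (Subgroup.zpowers ⁅x, y⁆).Normal := ⟨fun n hn g => by
    rwa [Subgroup.mem_center_iff.1 (hle hn) g, mul_inv_cancel_right]⟩
  set Z := Subgroup.zpowers ⁅x, y⁆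
  let π := QuotientGroup.mk' Z
  have hs : Function.Surjective π := QuotientGroup.mk'_surjective Z
  have hgen' : Subgroup.closure {π x, π y} = ⊤ := by
    rw [← Subgroup.map_top_of_surjective π hs, ← hgen, MonoidHom.map_closure, Set.image_pair]
  have hxy : π x * π y = π y * π x := by
    rw [← commutatorElement_eq_one_iff_mul_comm, ← map_commutatorElement]
    exact (QuotientGroup.eq_one_iff _).2 (Subgroup.mem_zpowers _)
  have h1 : (⊤ : Subgroup (G ⧸ Z)) ≤ Subgroup.centralizer {π x, π y} := by
    rw [← hgen', Subgroup.closure_le]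
    rintro _ (rfl | rfl) _ (rfl | rfl) <;> simp [hxy]
  have h2 : (⊤ : Subgroup (G ⧸ Z)) ≤ Subgroup.center _ := by
    rw [← hgen', Subgroup.closure_le]
    intro a ha
    exact Subgroup.mem_center_iff.2 fun g => (h1 (Subgroup.mem_top g) a ha).symm
  rw [commutator_def, Subgroup.commutator_le]
  intro a _ b _
  rw [← QuotientGroup.eq_one_iff (N := Z), ← QuotientGroup.mk'_apply, map_commutatorElement,
    commutatorElement_eq_one_iff_mul_comm]
  exact Subgroup.mem_center_iff.1 (h2 (Subgroup.mem_top _)) _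

/-- A maximal subgroup of a finite `p`-group contains all `p`-th powers and all commutators. -/
theorem isCoatom_pow_mem {G : Type*} [Group G] [Finite G] {p : ℕ} [Fact p.Prime]
    (hG : IsPGroup p G) {M : Subgroup G} (hM : IsCoatom M) :
    (∀ g, g ^ p ∈ M) ∧ commutator G ≤ M := by
  have : Group.IsNilpotent G := hG.isNilpotent
  have hn : M.Normal := Subgroup.NormalizerCondition.normal_of_coatom M
    Group.normalizerCondition_of_isNilpotent hM
  have hQ : IsPGroup p (G ⧸ M) := hG.to_quotient M
  have : Nontrivial (G ⧸ M) := QuotientGroup.nontrivial_iff.2 hM.1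
  have htop (K : Subgroup (G ⧸ M)) (hK : K ≠ ⊥) : K = ⊤ := by
    have h1 : K.comap (QuotientGroup.mk' M) = ⊤ := by
      refine hM.2 _ (lt_of_le_of_ne (QuotientGroup.le_comap_mk' M K) fun h => hK ?_)
      rw [← Subgroup.map_comap_eq_self_of_surjective (QuotientGroup.mk'_surjective M) K, ← h]
      simp
    rw [← Subgroup.map_comap_eq_self_of_surjective (QuotientGroup.mk'_surjective M) K, h1,
      Subgroup.map_top_of_surjective _ (QuotientGroup.mk'_surjective M)]
  have hcen := htop _ hQ.bot_lt_center.ne'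
  have hcomm (a b : G ⧸ M) : a * b = b * a :=
    Subgroup.mem_center_iff.1 (hcen ▸ Subgroup.mem_top b) a
  constructor
  · let K : Subgroup (G ⧸ M) :=
      { carrier := {a | a ^ p = 1}
        one_mem' := one_pow p
        mul_mem' := fun {a b} (ha : a ^ p = 1) (hb : b ^ p = 1) =>
          show (a * b) ^ p = 1 by rw [Commute.mul_pow (hcomm a b), ha, hb, one_mul]
        inv_mem' := fun {a} (ha : a ^ p = 1) =>
          show a⁻¹ ^ p = 1 by rw [inv_pow, ha, inv_one] }
    have hK : K ≠ ⊥ := by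
      have hdvd : p ∣ Nat.card (G ⧸ M) := by
        obtain ⟨n, hn, h⟩ := hQ.nontrivial_iff_card.1 inferInstance
        exact h ▸ dvd_pow_self p hn.ne'
      obtain ⟨a, ha⟩ := exists_prime_orderOf_dvd_card' p hdvd
      intro h
      have h2 : a ∈ K := show a ^ p = 1 from ha ▸ pow_orderOf_eq_one a
      rw [h, Subgroup.mem_bot] at h2
      rw [h2, orderOf_one] at ha
      exact (Fact.out : p.Prime).one_lt.ne ha
    intro g
    have h1 : (g : G ⧸ M) ∈ K := htop K hK ▸ Subgroup.mem_top _
    exact (QuotientGroup.eq_one_iff _).1 h1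
  · rw [commutator_def, Subgroup.commutator_le]
    intro a _ b _
    rw [← QuotientGroup.eq_one_iff (N := M), ← QuotientGroup.mk'_apply, map_commutatorElement,
      commutatorElement_eq_one_iff_mul_comm]
    exact hcomm _ _

/-- Frattini argument inside the `p`-group `D`: a maximal subgroup containing `H` would also contain
all `p`-th powers, hence everything. -/
theorem le_of_le_sup_powSubgroup {G : Type*} [Group G] [Finite G] {p : ℕ} [Fact p.Prime]
    (hG : IsPGroup p G) {H D : Subgroup G} (hHD : H ≤ D) (h : D ≤ H ⊔ powSubgroup D p) :
    D ≤ H := by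
  rw [← Subgroup.subgroupOf_eq_top]
  by_contra hne
  obtain ⟨M, hM, hle⟩ := (eq_top_or_exists_le_coatom (H.subgroupOf D)).resolve_left hne
  refine hM.1 (eq_top_iff.2 fun a _ => ?_)
  have h1 : H ⊔ powSubgroup D p ≤ M.map D.subtype := by
    refine sup_le (fun a ha => ⟨⟨a, hHD ha⟩, hle ha, rfl⟩) (powSubgroup_le fun a ha => ?_)
    exact ⟨⟨a, ha⟩ ^ p, (isCoatom_pow_mem (hG.to_subgroup D) hM).1 _, rfl⟩
  obtain ⟨b, hb, hba⟩ := h (a.2) |> @h1 _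
  rwa [← Subtype.ext hba]

/-- In a two-generated powerful finite `p`-group the commutator subgroup is cyclic. -/
theorem commutator_le_zpowers {G : Type*} [Group G] [Finite G] {p q : ℕ} [Fact p.Prime]
    (hG : IsPGroup p G) (hq : p ∣ q) (hq2 : p ∣ q.choose 2)
    (hD : commutator G ≤ powSubgroup ⊤ q) {x y : G} (hgen : Subgroup.closure {x, y} = ⊤) :
    commutator G ≤ Subgroup.zpowers ⁅x, y⁆ := by
  have : Group.IsNilpotent G := hG.isNilpotent
  refine le_of_le_sup_powSubgroup hG ?_ ?_
  · rw [Subgroup.zpowers_le]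
    exact Subgroup.commutator_mem_commutator (Subgroup.mem_top _) (Subgroup.mem_top _)
  -- By the Frattini argument it is enough to work modulo `p`-th powers of commutator elements.
  -- There the commutator subgroup has exponent dividing `p`, so it lies in the central subgroup of
  -- `q`-th powers.
  set N := powSubgroup (commutator G) p
  let π := QuotientGroup.mk' N
  have hs : Function.Surjective π := QuotientGroup.mk'_surjective N
  have hC := map_commutator_top hs
  have hDq : commutator (G ⧸ N) ≤ powSubgroup ⊤ q := by
    rw [← hC, ← map_powSubgroup_top hs]
    exact Subgroup.map_mono hD
  have hcen : powSubgroup (⊤ : Subgroup (G ⧸ N)) q ≤ Subgroup.center _ := by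
    refine powSubgroup_le_center_of_isNilpotent hq hq2 ?_ hDq
    rw [← hC]
    rintro _ ⟨d, hd, rfl⟩
    rw [← map_pow]
    exact (QuotientGroup.eq_one_iff _).2 (pow_mem_powSubgroup hd p)
  have hgen' : Subgroup.closure {π x, π y} = ⊤ := by
    rw [← Subgroup.map_top_of_surjective π hs, ← hgen, MonoidHom.map_closure, Set.image_pair]
  have h1 := commutator_le_zpowers_of_mem_center hgen' (hcen (hDq
    (Subgroup.commutator_mem_commutator (Subgroup.mem_top _) (Subgroup.mem_top _))))
  rw [← hC, ← map_commutatorElement, ← MonoidHom.map_zpowers, Subgroup.map_le_map_iff,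
    QuotientGroup.ker_mk'] at h1
  exact h1

theorem card_le_of_closure_pair {A : Type*} [CommGroup A] {x y : A}
    (hgen : Subgroup.closure {x, y} = ⊤) {k : ℕ} (hk : 0 < k) (hpow : ∀ a : A, a ^ k = 1) :
    Nat.card A ≤ k * k := by
  have hf (a : A) : Finite (Subgroup.zpowers a) :=
    (isOfFinOrder_iff_pow_eq_one.2 ⟨k, hk, hpow a⟩).finite_zpowers
  have hle (a : A) : Nat.card (Subgroup.zpowers a) ≤ k := by
    rw [Nat.card_zpowers]
    exact orderOf_le_of_pow_eq_one hk (hpow a)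
  have := hf x
  have := hf y
  have hsurj : Function.Surjective
      (fun a : Subgroup.zpowers x × Subgroup.zpowers y => (a.1 : A) * a.2) := fun a => by
    obtain ⟨m, n, h⟩ := Subgroup.mem_closure_pair.1 (hgen ▸ Subgroup.mem_top a)
    exact ⟨⟨⟨x ^ m, m, rfl⟩, ⟨y ^ n, n, rfl⟩⟩, h⟩
  calc Nat.card A ≤ _ := Nat.card_le_card_of_surjective _ hsurj
    _ = _ := Nat.card_prod _ _
    _ ≤ k * k := Nat.mul_le_mul (hle x) (hle y)

theorem exists_surjective_zmod_of_pow_ne_one {A : Type*} [CommGroup A] [Finite A] {p : ℕ}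
    [Fact p.Prime] (hA : IsPGroup p A) {n : ℕ} {a : A} (ha : a ^ p ^ n ≠ 1) :
    ∃ f : A →* Multiplicative (ZMod (p ^ (n + 1))), Function.Surjective f := by
  obtain ⟨ι, _, k, hk, ⟨e⟩⟩ := CommGroup.equiv_prod_multiplicative_zmod_of_finite A
  have h1 : ∃ i, (e a i) ^ p ^ n ≠ 1 := by
    by_contra! h
    exact ha (e.injective (by rw [map_pow, map_one]; exact funext h))
  obtain ⟨i, hi⟩ := h1
  classical
  have hs : Function.Surjective ((Pi.evalMonoidHom _ i).comp e.toMonoidHom :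
      A →* Multiplicative (ZMod (k i))) :=
    (Function.surjective_eval i).comp e.surjective
  have : NeZero (k i) := ⟨(zero_lt_one.trans (hk i)).ne'⟩
  obtain ⟨m, hm⟩ := IsPGroup.iff_card.1 (hA.of_surjective _ hs)
  have hm' : k i = p ^ m := by simpa using hm
  have hlt : n < m := by
    by_contra! h
    refine hi ?_
    have h2 : (e a i) ^ p ^ m = 1 := hm ▸ pow_card_eq_one'
    obtain ⟨c, hc⟩ := pow_dvd_pow p h
    rw [hc, pow_mul, h2, one_pow]
  have hdvd : p ^ (n + 1) ∣ k i := hm' ▸ pow_dvd_pow p hlt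
  exact ⟨(AddMonoidHom.toMultiplicative (ZMod.castHom hdvd (ZMod (p ^ (n + 1)))).toAddMonoidHom).comp
    ((Pi.evalMonoidHom _ i).comp e.toMonoidHom),
    (ZMod.castHom_surjective hdvd).comp hs⟩

theorem exists_surjective_zmod {G : Type*} [Group G] [Finite G] {p q : ℕ} [Fact p.Prime]
    (hG : IsPGroup p G) (hq : p ∣ q) (hq2 : p ∣ q.choose 2)
    (hD : commutator G ≤ powSubgroup ⊤ q) {x y : G} (hgen : Subgroup.closure {x, y} = ⊤)
    {n : ℕ} (hcard : orderOf ⁅x, y⁆ * p ^ (2 * n + 1) ≤ Nat.card G) :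
    ∃ f : G →* Multiplicative (ZMod (p ^ (n + 1))), Function.Surjective f := by
  have hp : 1 < p := (Fact.out : p.Prime).one_lt
  have h1 : Nat.card (commutator G) ≤ orderOf ⁅x, y⁆ := by
    rw [← Nat.card_zpowers]
    exact Subgroup.card_le_of_le (commutator_le_zpowers hG hq hq2 hD hgen)
  have hs : Function.Surjective (Abelianization.of : G →* Abelianization G) :=
    QuotientGroup.mk'_surjective _
  have h2 : p ^ (2 * n + 1) ≤ Nat.card (Abelianization G) := by
    have h3 : Nat.card G = Nat.card (Abelianization G) * Nat.card (commutator G) :=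
      Subgroup.card_eq_card_quotient_mul_card_subgroup _
    by_contra! h
    have h4 : Nat.card G < orderOf ⁅x, y⁆ * p ^ (2 * n + 1) := by
      rw [h3, mul_comm]
      exact Nat.mul_lt_mul_of_le_of_lt h1 h (orderOf_pos _)
    omega
  have h5 : ∃ a : Abelianization G, a ^ p ^ n ≠ 1 := by
    by_contra! h
    have hgen' : Subgroup.closure {Abelianization.of x, Abelianization.of y} = ⊤ := by
      rw [← Subgroup.map_top_of_surjective _ hs, ← hgen, MonoidHom.map_closure, Set.image_pair]
    have h6 := card_le_of_closure_pair hgen' (pow_pos (by omega) n) h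
    have h7 : p ^ n * p ^ n < p ^ (2 * n + 1) := by
      rw [← pow_add]
      exact Nat.pow_lt_pow_right hp (by omega)
    omega
  obtain ⟨a, ha⟩ := h5
  obtain ⟨f, hf⟩ := exists_surjective_zmod_of_pow_ne_one (hG.of_surjective _ hs) ha
  exact ⟨f.comp Abelianization.of, hf.comp hs⟩

/-! ### The lower `p`-series -/

section LowerPSeries

variable {G : Type*} [Group G] [TopologicalSpace G] [IsTopologicalGroup G]

instance lowerPSeries_normal (p i : ℕ) : (lowerPSeries p G i).Normal := by
  induction i with
  | zero => exact inferInstanceAs (⊤ : Subgroup G).Normal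
  | succ i ih => rw [lowerPSeries]; infer_instance

theorem isClosed_lowerPSeries (p i : ℕ) : IsClosed (lowerPSeries p G i : Set G) := by
  cases i with
  | zero => exact isClosed_univ
  | succ i => exact Subgroup.isClosed_topologicalClosure _

theorem lowerPSeries_succ_le {p i : ℕ} {H : Subgroup G} (hH : IsClosed (H : Set G))
    (hpow : ∀ x ∈ lowerPSeries p G i, x ^ p ∈ H)
    (hcomm : ∀ x ∈ lowerPSeries p G i, ∀ g, ⁅x, g⁆ ∈ H) : lowerPSeries p G (i + 1) ≤ H :=
  Subgroup.topologicalClosure_minimal _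
    (sup_le (powSubgroup_le hpow) (Subgroup.commutator_le.2 fun x hx g _ => hcomm x hx g)) hH

theorem pow_mem_lowerPSeries_succ {p i : ℕ} {x : G} (hx : x ∈ lowerPSeries p G i) :
    x ^ p ∈ lowerPSeries p G (i + 1) :=
  Subgroup.le_topologicalClosure _ (le_sup_left (α := Subgroup G) (pow_mem_powSubgroup hx p))

theorem commutator_mem_lowerPSeries_succ {p i : ℕ} {x : G} (hx : x ∈ lowerPSeries p G i) (g : G) :
    ⁅x, g⁆ ∈ lowerPSeries p G (i + 1) :=
  Subgroup.le_topologicalClosure _ (le_sup_right (α := Subgroup G)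
    (Subgroup.commutator_mem_commutator hx (Subgroup.mem_top g)))

theorem lowerPSeries_succ_le_self (p i : ℕ) : lowerPSeries p G (i + 1) ≤ lowerPSeries p G i :=
  lowerPSeries_succ_le (isClosed_lowerPSeries p i) (fun _ hx => pow_mem hx p)
    fun _ hx g => Subgroup.commutator_le_left _ ⊤
      (Subgroup.commutator_mem_commutator hx (Subgroup.mem_top g))

theorem pow_pow_mem_lowerPSeries (p i : ℕ) (x : G) : x ^ p ^ i ∈ lowerPSeries p G i := by
  induction i with
  | zero => exact Subgroup.mem_top _
  | succ i ih => rw [pow_succ, pow_mul]; exact pow_mem_lowerPSeries_succ ih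

theorem index_lowerPSeries {p : ℕ}
    (h : ∀ i : ℕ, (lowerPSeries p G (i + 1)).relIndex (lowerPSeries p G i) =
      (lowerPSeries p G 1).index) (i : ℕ) :
    (lowerPSeries p G i).index = (lowerPSeries p G 1).index ^ i := by
  induction i with
  | zero => exact Subgroup.index_top
  | succ i ih =>
    rw [← Subgroup.relIndex_mul_index (lowerPSeries_succ_le_self p i), h, ih, pow_succ']

theorem finite_closure_of_commute {A : Type*} [Group A] (hcomm : ∀ a b : A, a * b = b * a) {p : ℕ}
    (hp : 0 < p) (hpow : ∀ a : A, a ^ p = 1) {X : Set A} (hX : X.Finite) :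
    (Subgroup.closure X : Set A).Finite := by
  let _ : CommGroup A := { ‹Group A› with mul_comm := hcomm }
  have : Group.FG (Subgroup.closure X) := (Group.fg_iff_subgroup_fg _).2 ⟨hX.toFinset, by simp⟩
  have : Finite (Subgroup.closure X) := CommGroup.finite_of_fg_isMulTorsion _ fun a =>
    isOfFinOrder_iff_pow_eq_one.2 ⟨p, hp, Subtype.ext (hpow _)⟩
  exact Set.toFinite _

/-- The quotient is abelian of exponent dividing `p`, so a finite topological generating set has an
image generating a finite, hence closed, subgroup; being also dense, it is everything. -/
theorem finiteIndex_lowerPSeries_one {p : ℕ} (hp : 0 < p) (hG : IsTopologicallyFG G) :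
    (lowerPSeries p G 1).FiniteIndex := by
  obtain ⟨X, hX, hXd⟩ := hG
  set P := lowerPSeries p G 1
  have : IsClosed (P : Set G) := isClosed_lowerPSeries p 1
  have hfin : (Subgroup.closure (QuotientGroup.mk' P '' X) : Set (G ⧸ P)).Finite := by
    refine finite_closure_of_commute ?_ hp ?_ (hX.image _)
    · intro a b
      obtain ⟨a, rfl⟩ := QuotientGroup.mk'_surjective P a
      obtain ⟨b, rfl⟩ := QuotientGroup.mk'_surjective P b
      rw [← commutatorElement_eq_one_iff_mul_comm, ← map_commutatorElement]
      exact (QuotientGroup.eq_one_iff _).2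
        (commutator_mem_lowerPSeries_succ (i := 0) (Subgroup.mem_top a) b)
    · intro a
      obtain ⟨a, rfl⟩ := QuotientGroup.mk'_surjective P a
      rw [← map_pow]
      exact (QuotientGroup.eq_one_iff _).2 (pow_mem_lowerPSeries_succ (i := 0) (Subgroup.mem_top a))
  rw [← MonoidHom.map_closure] at hfin
  have hcl : IsClosed (((Subgroup.closure X).map (QuotientGroup.mk' P)).comap
      (QuotientGroup.mk' P) : Set G) :=
    hfin.isClosed.preimage continuous_quotient_mk'
  have htop : (⊤ : Subgroup G) ≤ ((Subgroup.closure X).map (QuotientGroup.mk' P)).comap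
      (QuotientGroup.mk' P) := by
    rw [← hXd]
    exact Subgroup.topologicalClosure_minimal _ (Subgroup.le_comap_map _ _) hcl
  have : Finite (G ⧸ P) := by
    rw [← Set.finite_univ_iff]
    refine hfin.subset fun a _ => ?_
    obtain ⟨a, rfl⟩ := QuotientGroup.mk'_surjective P a
    exact htop (Subgroup.mem_top a)
  exact Subgroup.finiteIndex_of_finite_quotient

/-- The target is abelian, so commutators die and each `p`-th power contributes a factor `p`.
Openness of the kernel makes the preimage of an ideal closed, which handles the closures in the
series. -/
theorem dvd_of_mem_lowerPSeries {p N : ℕ} (f : G →* Multiplicative (ZMod N))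
    (hf : IsOpen (f.ker : Set G)) (k : ℕ) {g : G} (hg : g ∈ lowerPSeries p G k) :
    (p ^ k : ZMod N) ∣ (f g).toAdd := by
  induction k generalizing g with
  | zero => simp
  | succ k ih =>
    let S : Subgroup G := (AddSubgroup.toSubgroup
      (Ideal.span {(p ^ (k + 1) : ZMod N)}).toAddSubgroup).comap f
    have hS (g : G) : g ∈ S ↔ (p ^ (k + 1) : ZMod N) ∣ (f g).toAdd := Ideal.mem_span_singleton
    have hle : f.ker ≤ S := fun g hg => (hS g).2 (by rw [MonoidHom.mem_ker.1 hg]; simp)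
    have hcl : IsClosed (S : Set G) := S.isClosed_of_isOpen (Subgroup.isOpen_mono hle hf)
    refine (hS g).1 (lowerPSeries_succ_le hcl (fun x hx => ?_) (fun x _ y => ?_) hg)
    · rw [hS, map_pow, toAdd_pow, nsmul_eq_mul, pow_succ']
      exact mul_dvd_mul_left _ (ih hx)
    · exact hle (by rw [MonoidHom.mem_ker, map_commutatorElement,
        commutatorElement_eq_one_iff_mul_comm, mul_comm])

end LowerPSeries

/-! ### The Frattini subgroup -/

section Frattini

theorem isPGroup_quotient {p : ℕ} {G : Type*} [Group G] [TopologicalSpace G] (hG : IsProP p G)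
    {U : Subgroup G} [U.Normal]
    (hU : IsOpen (U : Set G)) : IsPGroup p (G ⧸ U) := by
  obtain ⟨k, hk⟩ := hG U inferInstance hU
  exact IsPGroup.of_card hk

variable {G : Type*} [Group G] [TopologicalSpace G] [IsTopologicalGroup G] [CompactSpace G]

theorem finiteIndex_of_isOpen {U : Subgroup G} (hU : IsOpen (U : Set G)) : U.FiniteIndex :=
  have := U.quotient_finite_of_isOpen hU
  Subgroup.finiteIndex_of_finite_quotient

/-- Modulo its normal core, a maximal open subgroup becomes a maximal subgroup of a finite
`p`-group. -/
theorem lowerPSeries_one_le_frattiniSubgroup {p : ℕ} [Fact p.Prime] (hG : IsProP p G) :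
    lowerPSeries p G 1 ≤ frattiniSubgroup G := by
  refine le_sInf fun M (hM : Maximal (fun H : Subgroup G => IsOpen (H : Set G) ∧ H ≠ ⊤) M) => ?_
  have hMo := hM.prop.1
  have hMc := M.isClosed_of_isOpen hMo
  have := finiteIndex_of_isOpen hMo
  set U := M.normalCore
  have hU : IsOpen (U : Set G) :=
    U.isOpen_of_isClosed_of_finiteIndex (M.normalCore_isClosed hMc)
  have := U.quotient_finite_of_isOpen hU
  set π := QuotientGroup.mk' U
  have hs : Function.Surjective π := QuotientGroup.mk'_surjective U
  have hcm : (M.map π).comap π = M := by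
    rw [Subgroup.comap_map_eq, QuotientGroup.ker_mk', sup_eq_left]
    exact M.normalCore_le
  have hco : IsCoatom (M.map π) := by
    refine ⟨fun h => hM.prop.2 ?_, fun K hK => ?_⟩
    · rw [← hcm, h, Subgroup.comap_top]
    · by_contra hne
      have h1 : M ≤ K.comap π := Subgroup.map_le_iff_le_comap.1 hK.le
      have h2 : K.comap π ≤ M := hM.2 ⟨Subgroup.isOpen_mono h1 hMo, fun h => hne ?_⟩ h1
      · exact hK.not_ge (by
          rw [← Subgroup.map_comap_eq_self_of_surjective hs K]
          exact Subgroup.map_mono h2)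
      · rw [← Subgroup.map_comap_eq_self_of_surjective hs K, h,
          Subgroup.map_top_of_surjective _ hs]
  have key := isCoatom_pow_mem (isPGroup_quotient hG hU) hco
  refine lowerPSeries_succ_le hMc (fun x _ => ?_) (fun x _ g => ?_)
  · rw [← hcm, Subgroup.mem_comap, map_pow]
    exact key.1 _
  · rw [← hcm, Subgroup.mem_comap, map_commutatorElement]
    exact key.2 (Subgroup.commutator_mem_commutator (Subgroup.mem_top _) (Subgroup.mem_top _))

theorem exists_le_maximal_open {N : Subgroup G} (hN : IsOpen (N : Set G)) (hne : N ≠ ⊤) :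
    ∃ M, N ≤ M ∧ Maximal (fun H : Subgroup G => IsOpen (H : Set G) ∧ H ≠ ⊤) M := by
  obtain ⟨M, ⟨hNM, hMt⟩, hmin⟩ := WellFounded.has_min
    (measure fun M : Subgroup G => M.index).wf {M | N ≤ M ∧ M ≠ ⊤} ⟨N, le_rfl, hne⟩
  refine ⟨M, hNM, ⟨Subgroup.isOpen_mono hNM hN, hMt⟩, fun K hK hMK => ?_⟩
  have h1 : ¬ K.index < M.index := hmin K ⟨hNM.trans hMK, hK.2⟩
  have := finiteIndex_of_isOpen hK.1
  have h2 := Subgroup.relIndex_mul_index hMK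
  rw [← Subgroup.relIndex_eq_one]
  have := finiteIndex_of_isOpen (Subgroup.isOpen_mono hNM hN)
  have h3 : M.index ≠ 0 := Subgroup.FiniteIndex.index_ne_zero
  have h4 : K.index ≠ 0 := Subgroup.FiniteIndex.index_ne_zero
  by_contra h5
  have h6 : M.relIndex K ≠ 0 := fun h => h3 (by rw [← h2, h, zero_mul])
  have h7 : 2 ≤ M.relIndex K := by omega
  have h8 := Nat.mul_le_mul_right K.index h7
  omega

variable [TotallyDisconnectedSpace G]

/-- A proper closed subgroup of a profinite group lies in a proper open one, hence in a maximal open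
one, which also contains the Frattini subgroup. -/
theorem topologicalClosure_closure_eq_top {S : Set G}
    (hS : (Subgroup.closure S).map (QuotientGroup.mk' (frattiniSubgroup G)) = ⊤) :
    (Subgroup.closure S).topologicalClosure = ⊤ := by
  by_contra hne
  let K : ClosedSubgroup G :=
    { (Subgroup.closure S).topologicalClosure with
      isClosed' := Subgroup.isClosed_topologicalClosure _ }
  have hK := ProfiniteGrp.closedSubgroup_eq_sInf_open K
  have h1 : ∃ N : Subgroup G, (IsOpen (N : Set G) ∧ K.toSubgroup ≤ N) ∧ N ≠ ⊤ := by
    by_contra! h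
    exact hne (hK.trans (sInf_eq_top.2 h))
  obtain ⟨N, ⟨hN, hKN⟩, hNt⟩ := h1
  obtain ⟨M, hNM, hM⟩ := exists_le_maximal_open hN hNt
  have hSM : Subgroup.closure S ≤ M :=
    (Subgroup.le_topologicalClosure _).trans (hKN.trans hNM)
  refine hM.prop.2 (eq_top_iff.2 fun g _ => ?_)
  obtain ⟨h, hh, hg⟩ : QuotientGroup.mk' (frattiniSubgroup G) g ∈
    (Subgroup.closure S).map (QuotientGroup.mk' (frattiniSubgroup G)) := hS ▸ Subgroup.mem_top _
  have h2 : h⁻¹ * g ∈ M := (sInf_le hM : frattiniSubgroup G ≤ M) (QuotientGroup.eq.1 hg)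
  simpa using mul_mem (hSM hh) h2

theorem exists_topologicalClosure_range_eq_top {p d : ℕ} (h : HasDimension p G d) [NeZero p] :
    ∃ s : Fin d → G, (Subgroup.closure (Set.range s)).topologicalClosure = ⊤ := by
  obtain ⟨e⟩ := h
  let π := e.toMonoidHom.comp (QuotientGroup.mk' (frattiniSubgroup G))
  have hπ : Function.Surjective π := e.surjective.comp (QuotientGroup.mk'_surjective _)
  choose s hs using fun i : Fin d => hπ (Multiplicative.ofAdd (Pi.single i 1))
  have key : (Subgroup.closure (Set.range s)).map π = ⊤ := by
    refine eq_top_iff.2 fun v _ => ?_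
    have hv : v = ∏ i, π (s i) ^ (v.toAdd i).val := by
      apply Multiplicative.toAdd.injective
      rw [toAdd_prod]
      funext j
      simp only [hs, toAdd_pow, toAdd_ofAdd, Finset.sum_apply, Pi.smul_apply, Pi.single_apply]
      simp
    rw [hv]
    exact prod_mem fun i _ => pow_mem
      (Subgroup.mem_map_of_mem π (Subgroup.subset_closure (Set.mem_range_self i))) _
  refine ⟨s, topologicalClosure_closure_eq_top ?_⟩
  refine Subgroup.map_injective (f := e.toMonoidHom) e.injective ?_
  rw [Subgroup.map_map, key, Subgroup.map_top_of_surjective _ e.surjective]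

end Frattini

/-! ### Limits of homomorphisms to finite cyclic groups -/

theorem exists_limit_hom {p : ℕ} [Fact p.Prime] {G : Type*} [Group G] [TopologicalSpace G]
    [IsTopologicalGroup G] [CompactSpace G] (P : ℕ → Subgroup G)
    (hP : ∀ k, IsOpen (P k : Set G)) (f : ∀ n, G →* Multiplicative (ZMod (p ^ (n + 1))))
    (hf : ∀ n, Function.Surjective (f n))
    (hfP : ∀ n k, ∀ g ∈ P k, (p ^ k : ZMod (p ^ (n + 1))) ∣ (f n g).toAdd) :
    ∃ φ : G →* Multiplicative ℤ_[p], Continuous φ ∧ Function.Surjective φ := by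
  have hp : 1 < p := (Fact.out : p.Prime).one_lt
  -- These integer lifts are additive only modulo `p ^ (n + 1)`; the error vanishes in the limit.
  let F (n : ℕ) (g : G) : ℤ_[p] := ((f n g).toAdd.val : ℤ_[p])
  have hF (n : ℕ) (g : G) : PadicInt.toZModPow (n + 1) (F n g) = (f n g).toAdd := by
    simp [F]
  have hnorm {n : ℕ} {z : ℤ_[p]} {k : ℕ} (hk : k ≤ n + 1)
      (h : (p ^ k : ZMod (p ^ (n + 1))) ∣ PadicInt.toZModPow (n + 1) z) :
      ‖z‖ ≤ (p : ℝ) ^ (-(k : ℤ)) := by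
    obtain ⟨c, hc⟩ := h
    obtain ⟨c, rfl⟩ := ZMod.ringHom_surjective (PadicInt.toZModPow (n + 1)) c
    have h1 : z - p ^ k * c ∈ RingHom.ker (PadicInt.toZModPow (p := p) (n + 1)) := by
      rw [RingHom.mem_ker, map_sub, hc]
      simp
    rw [PadicInt.ker_toZModPow, Ideal.mem_span_singleton] at h1
    rw [PadicInt.norm_le_pow_iff_mem_span_pow, Ideal.mem_span_singleton]
    exact (dvd_sub_left (dvd_mul_right _ _)).1 ((pow_dvd_pow _ hk).trans h1)
  let φ (g : G) : ℤ_[p] := ((hyperfilter ℕ).map fun n => F n g).lim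
  have hφ (g : G) : Tendsto (fun n => F n g) (hyperfilter ℕ) (𝓝 (φ g)) :=
    Ultrafilter.le_nhds_lim _
  have hlarge (k : ℕ) : ∀ᶠ n in (hyperfilter ℕ : Filter ℕ), k ≤ n + 1 :=
    Nat.hyperfilter_le_atTop ((eventually_ge_atTop k).mono fun n hn => by omega)
  have hlim {z : ℕ → ℤ_[p]} {a : ℤ_[p]} (hz : Tendsto z (hyperfilter ℕ) (𝓝 a)) {k : ℕ}
      (h : ∀ᶠ n in (hyperfilter ℕ : Filter ℕ),
        (p ^ k : ZMod (p ^ (n + 1))) ∣ PadicInt.toZModPow (n + 1) (z n)) :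
      ‖a‖ ≤ (p : ℝ) ^ (-(k : ℤ)) :=
    le_of_tendsto hz.norm (by filter_upwards [h, hlarge k] with n h1 h2 using hnorm h2 h1)
  have hpow : Tendsto (fun k : ℕ => (p : ℝ) ^ (-(k : ℤ))) atTop (𝓝 0) := by
    simpa using tendsto_pow_atTop_nhds_zero_of_lt_one (r := (p : ℝ)⁻¹) (by positivity)
      (inv_lt_one_of_one_lt₀ (by exact_mod_cast hp))
  have hadd (g h : G) : φ (g * h) = φ g + φ h := by
    rw [← sub_eq_zero, ← norm_le_zero_iff]
    refine ge_of_tendsto' hpow fun k =>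
      hlim ((hφ (g * h)).sub ((hφ g).add (hφ h))) (.of_forall fun n => ?_)
    simp [hF]
  let Φ : G →* Multiplicative ℤ_[p] := MonoidHom.mk' (fun g => Multiplicative.ofAdd (φ g)) hadd
  have hcont : Continuous Φ := by
    refine continuous_of_continuousAt_one Φ ?_
    have h1 : φ 1 = 0 := congrArg Multiplicative.toAdd (map_one Φ)
    have h2 : ContinuousAt φ 1 := by
      rw [ContinuousAt, h1, tendsto_zero_iff_norm_tendsto_zero, Metric.tendsto_nhds]
      intro ε hε
      obtain ⟨k, hk⟩ := (hpow.eventually (gt_mem_nhds hε)).exists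
      filter_upwards [(hP k).mem_nhds (one_mem _)] with g hg
      have h3 := hlim (hφ g) (.of_forall fun n => by rw [hF]; exact hfP n k g hg)
      simpa using h3.trans_lt hk
    exact h2
  have hunit : ∃ g, IsUnit (φ g) := by
    -- A limit `g` of preimages of `1` differs from `x n` by an element of `P 1` for almost all `n`,
    -- so `φ g ≡ 1` modulo `p`.
    choose x hx using fun n => hf n (Multiplicative.ofAdd 1)
    let g := ((hyperfilter ℕ).map x).lim
    have hg : Tendsto x (hyperfilter ℕ) (𝓝 g) := Ultrafilter.le_nhds_lim _
    have h1 : ∀ᶠ n in (hyperfilter ℕ : Filter ℕ), (x n)⁻¹ * g ∈ P 1 := by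
      have h2 : Tendsto (fun n => (x n)⁻¹ * g) (hyperfilter ℕ) (𝓝 1) := by
        simpa using hg.inv.mul_const g
      exact h2 ((hP 1).mem_nhds (one_mem _))
    have h3 : ‖φ g - 1‖ ≤ (p : ℝ) ^ (-((1 : ℕ) : ℤ)) := by
      refine hlim ((hφ g).sub_const 1) (h1.mono fun n hn => ?_)
      have h4 := hfP n 1 _ hn
      rw [map_mul, map_inv, hx] at h4
      simpa [hF, neg_add_eq_sub] using h4
    refine ⟨g, ?_⟩
    by_contra h
    have h5 : ‖φ g - 1‖ < 1 := h3.trans_lt (by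
      simpa using inv_lt_one_of_one_lt₀ (by exact_mod_cast hp : (1 : ℝ) < p))
    have h6 : φ g - 1 ∈ nonunits ℤ_[p] := PadicInt.mem_nonunits.2 h5
    have h7 := IsLocalRing.nonunits_add (show φ g ∈ nonunits ℤ_[p] from h)
      (show 1 - φ g ∈ nonunits ℤ_[p] by rw [PadicInt.mem_nonunits, norm_sub_rev]; exact h5)
    simp at h7
  refine ⟨Φ, hcont, fun z => ?_⟩
  obtain ⟨g, u, hu⟩ := hunit
  have hcl : IsClosed (Set.range φ) := (isCompact_range (show Continuous φ from hcont)).isClosed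
  -- The image is closed and contains all integer multiples of the unit `u`; integers are dense in
  -- `ℤ_[p]`.
  have h1 : ∀ z : ℤ_[p], z * u ∈ Set.range φ := fun z => by
    induction z using PadicInt.denseRange_intCast.induction_on with
    | hp => exact hcl.preimage (by fun_prop)
    | ih a =>
      refine ⟨g ^ a, ?_⟩
      have h2 : φ (g ^ a) = a • φ g := congrArg Multiplicative.toAdd (map_zpow Φ g a)
      rw [h2, hu, zsmul_eq_mul]
  obtain ⟨h, hh⟩ := h1 (z.toAdd * ↑u⁻¹)
  refine ⟨h, show φ h = z.toAdd from ?_⟩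
  simpa using hh

/-! ### Uniform groups of dimension at most two -/

theorem exists_surjective_zmod_of_isUniform {p : ℕ} [Fact p.Prime] {G : Type*} [Group G]
    [TopologicalSpace G] [IsTopologicalGroup G] [CompactSpace G] [TotallyDisconnectedSpace G]
    (hG : IsUniform p G) {d : ℕ} (hdim : HasDimension p G d) (hd : d = 1 ∨ d = 2)
    (hopen : ∀ k, IsOpen (lowerPSeries p G k : Set G))
    (n : ℕ) : ∃ f : G →* Multiplicative (ZMod (p ^ (n + 1))),
      Function.Surjective f ∧ IsOpen (f.ker : Set G) := by
  have hp : 1 < p := (Fact.out : p.Prime).one_lt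
  set m := 2 * n + 1 with hm
  set P := lowerPSeries p G m with hPdef
  have hP : IsOpen (P : Set G) := hopen m
  set π := QuotientGroup.mk' P
  have hs : Function.Surjective π := QuotientGroup.mk'_surjective P
  have := P.quotient_finite_of_isOpen hP
  have hpow (a : G ⧸ P) : a ^ p ^ m = 1 := by
    obtain ⟨a, rfl⟩ := hs a
    rw [← map_pow]
    exact (QuotientGroup.eq_one_iff _).2 (pow_pow_mem_lowerPSeries p m a)
  have hcl (H : Subgroup (G ⧸ P)) : IsClosed (H.comap π : Set G) :=
    Subgroup.isClosed_of_isOpen _ (Subgroup.isOpen_mono (QuotientGroup.le_comap_mk' P H) hP)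
  have hcard : p ^ (d * m) ≤ Nat.card (G ⧸ P) := by
    have h1 : (frattiniSubgroup G).index = p ^ d := by
      obtain ⟨e⟩ := hdim
      rw [Subgroup.index, Nat.card_congr e.toEquiv]
      simp
    have h2 := Subgroup.index_dvd_of_le (lowerPSeries_one_le_frattiniSubgroup hG.isProP)
    have := finiteIndex_of_isOpen (hopen 1)
    have h3 := Nat.le_of_dvd (Nat.pos_of_ne_zero Subgroup.FiniteIndex.index_ne_zero) h2
    have h4 : Nat.card (G ⧸ P) = (lowerPSeries p G 1).index ^ m := index_lowerPSeries hG.index_eq m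
    rw [h4, pow_mul, ← h1]
    exact Nat.pow_le_pow_left h3 m
  obtain ⟨q, hq, hq2, hD⟩ : ∃ q, p ∣ q ∧ p ∣ q.choose 2 ∧
      commutator (G ⧸ P) ≤ powSubgroup ⊤ q := by
    have h1 (q : ℕ) (h : ∀ x y : G ⧸ (powSubgroup (⊤ : Subgroup G) q).topologicalClosure,
        x * y = y * x) : commutator (G ⧸ P) ≤ powSubgroup ⊤ q := by
      have h2 : (powSubgroup (⊤ : Subgroup G) q).topologicalClosure ≤
          (powSubgroup ⊤ q).comap π := by
        refine Subgroup.topologicalClosure_minimal _ ?_ (hcl _)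
        rw [← map_powSubgroup_top hs]
        exact Subgroup.le_comap_map _ _
      rw [← map_commutator_top hs, Subgroup.map_le_iff_le_comap, commutator_def,
        Subgroup.commutator_le]
      intro a _ b _
      refine h2 ?_
      rw [← QuotientGroup.eq_one_iff, ← QuotientGroup.mk'_apply, map_commutatorElement,
        commutatorElement_eq_one_iff_mul_comm]
      exact h _ _
    -- The choice is `q = p` for odd `p`. For `p = 2`, `q = 2` would fail since `choose 2 2 = 1`,
    -- whereas `choose 4 2 = 6` is even.
    rcases hG.powerful with ⟨hodd, h⟩ | ⟨rfl, h⟩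
    · refine ⟨p, dvd_rfl, Nat.Prime.dvd_choose_self Fact.out two_ne_zero ?_, h1 p h⟩
      exact lt_of_le_of_ne hp (fun h => by rw [← h] at hodd; exact absurd hodd (by decide))
    · exact ⟨4, by decide, by decide, h1 4 h⟩
  obtain ⟨s, hsd⟩ := exists_topologicalClosure_range_eq_top hdim
  have hgen (x y : G) (h : Set.range s ⊆ {x, y}) : Subgroup.closure {π x, π y} = ⊤ := by
    have h1 : (⊤ : Subgroup G) ≤ (Subgroup.closure {π x, π y}).comap π := by
      rw [← hsd]
      refine Subgroup.topologicalClosure_minimal _ ?_ (hcl _)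
      rw [← Subgroup.map_le_iff_le_comap, MonoidHom.map_closure, ← Set.image_pair]
      exact Subgroup.closure_mono (Set.image_mono h)
    refine eq_top_iff.2 fun a _ => ?_
    obtain ⟨a, rfl⟩ := hs a
    exact h1 (Subgroup.mem_top a)
  obtain ⟨x, y, hxy, hord⟩ : ∃ x y : G, Set.range s ⊆ {x, y} ∧
      orderOf ⁅π x, π y⁆ * p ^ m ≤ Nat.card (G ⧸ P) := by
    rcases hd with rfl | rfl
    -- Padding with the generator `1` makes the commutator trivial, so its order is `1`.
    · refine ⟨s 0, 1, ?_, ?_⟩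
      · rintro _ ⟨i, rfl⟩
        fin_cases i; simp
      · simpa using hcard
    · refine ⟨s 0, s 1, ?_, le_trans ?_ hcard⟩
      · rintro _ ⟨i, rfl⟩
        fin_cases i <;> simp
      · rw [two_mul m, pow_add p m m]
        exact Nat.mul_le_mul_right _ (orderOf_le_of_pow_eq_one (by positivity) (hpow _))
  obtain ⟨f, hf⟩ := exists_surjective_zmod (isPGroup_quotient hG.isProP hP) hq hq2 hD
    (hgen x y hxy) hord
  refine ⟨f.comp π, hf.comp hs, Subgroup.isOpen_mono (fun a ha => ?_) hP⟩
  have h1 : π a = 1 := (QuotientGroup.eq_one_iff a).2 ha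
  rw [MonoidHom.mem_ker, MonoidHom.comp_apply, h1, map_one]

theorem nonempty_quotient_ker_continuousMulEquiv {G A : Type*} [Group G] [TopologicalSpace G]
    [CompactSpace G] [Group A] [TopologicalSpace A] [T2Space A] (φ : G →* A)
    (hc : Continuous φ) (hs : Function.Surjective φ) : Nonempty ((G ⧸ φ.ker) ≃ₜ* A) := by
  let e := QuotientGroup.quotientKerEquivOfSurjective φ hs
  have he : Continuous e := hc.quotient_lift _
  exact ⟨{ e with
    continuous_toFun := he
    continuous_invFun := (Continuous.homeoOfEquivCompactToT2 (f := e.toEquiv) he).symm.continuous }⟩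

end UniformProP

theorem mainTheorem6 (p : ℕ) [Fact p.Prime] (G : Type*) [Group G] [TopologicalSpace G]
    [IsTopologicalGroup G] [CompactSpace G] [TotallyDisconnectedSpace G]
    (hG : UniformProP.IsUniform p G) (d : ℕ) (hdim : UniformProP.HasDimension p G d)
    (hd : d = 1 ∨ d = 2) :
    ∃ (N : Subgroup G) (_ : N.Normal), IsClosed (N : Set G) ∧
      Nonempty ((G ⧸ N) ≃ₜ* Multiplicative ℤ_[p]) := by
  have hp : 0 < p := (Fact.out : p.Prime).pos
  have hopen (k : ℕ) : IsOpen (UniformProP.lowerPSeries p G k : Set G) := by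
    have := UniformProP.finiteIndex_lowerPSeries_one hp hG.finitelyGenerated
    have : (UniformProP.lowerPSeries p G k).FiniteIndex := ⟨by
      rw [UniformProP.index_lowerPSeries hG.index_eq]
      exact pow_ne_zero _ Subgroup.FiniteIndex.index_ne_zero⟩
    exact Subgroup.isOpen_of_isClosed_of_finiteIndex _ (UniformProP.isClosed_lowerPSeries p k)
  choose f hf hker using UniformProP.exists_surjective_zmod_of_isUniform hG hdim hd hopen
  obtain ⟨φ, hφ, hs⟩ := UniformProP.exists_limit_hom _ hopen f hf
    fun n k g hg => UniformProP.dvd_of_mem_lowerPSeries (f n) (hker n) k hg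
  exact ⟨φ.ker, inferInstance, isClosed_singleton.preimage hφ,
    UniformProP.nonempty_quotient_ker_continuousMulEquiv φ hφ hs⟩
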